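/- Let $S$ be a finite set. An $S$-valued stochastic process on an index set $T$ is understood in the weak sense, as a consistent family of finite-dimensional distributions $F_{t_1,\dots,t_k}(s_1,\dots,s_k)=\mathbb{P}(X(t_1)=s_1,\dots,X(t_k)=s_k)$; by consistent we mean that each $F_{t_1,\dots,t_k}$ is a probability distribution on $S^k$, that summing $F_{t_1,\dots,t_{k+1}}(s_1,\dots,s_k,z)$ over $z\in S$ gives $F_{t_1,\dots,t_k}(s_1,\dots,s_k)$, that permuting the indices and the states simultaneously does not change the value, and that $\sum_{s\in S}F_{t,t}(s,s)=1$. Put $d(t_1,t_2)=1-\sum_{s\in S}F_{t_1,t_2}(s,s)=\mathbb{P}(X(t_1)\neq X(t_2))$. The process is non-degenerate if $d(t_1,t_2)>0$ whenever $t_1\neq t_2$; in that case $d$ is a metric on $T$, and the process is called separable (complete) if $(T,d)$ is separable (complete). A map $\phi:T\to U$ embeds a process $X$ on $T$ in a process $Y$ on $U$ if $(Y_{\phi(t)})_{t\in T}$ and $(X_t)_{t\in T}$ have the same finite-dimensional distributions; an isomorphism is a surjective embedding, and an automorphism is an isomorphism from a process to itself. A process is universal if every $S$-valued process with finite index set embeds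 in it. It is ultrahomogeneous if every embedding into it of its restriction to a finite subset $T_0\subseteq T$ extends to an automorphism. Then there is a complete separable non-degenerate $S$-valued stochastic process $(\mathbb{X}_t)_{t\in\mathbb{T}}$, given by random variables on some probability space, that is universal and ultrahomogeneous. It is unique up to isomorphism: every complete separable non-degenerate universal ultrahomogeneous $S$-valued process is isomorphic to it. -/

import Mathlib

open MeasureTheory

universe u v w

/-- An `S`-valued stochastic process on the index set `T` in the weak sense, i.e. a consistent family
of finite-dimensional distributions: `F.prob t s` is
`P (X (t 0) = s 0, …, X (t (k-1)) = s (k-1))`, for every `k`-tuple `t` of indices and every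
`k`-tuple `s` of states.

Tuples with repeated entries are allowed. The field `prob_diag` says that the two coordinates of
`(X t, X t)` agree almost surely; with the other fields it makes the values at tuples with repetitions
the ones dictated by the values at tuples of distinct indices. -/
structure ProcessLaw (S : Type u) [Fintype S] (T : Type v) where
  prob : ∀ {k : ℕ}, (Fin k → T) → (Fin k → S) → ℝ
  prob_mem : ∀ {k : ℕ} (t : Fin k → T) (s : Fin k → S), prob t s ∈ Set.Icc (0 : ℝ) 1
  prob_sum : ∀ {k : ℕ} (t : Fin k → T), ∑ s : Fin k → S, prob t s = 1
  prob_marginal : ∀ {k : ℕ} (t : Fin k → T) (t' : T) (s : Fin k → S),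
    ∑ z : S, prob (Fin.snoc t t' : Fin (k + 1) → T) (Fin.snoc s z : Fin (k + 1) → S) = prob t s
  prob_perm : ∀ {k : ℕ} (σ : Equiv.Perm (Fin k)) (t : Fin k → T) (s : Fin k → S),
    prob (t ∘ σ) (s ∘ σ) = prob t s
  prob_diag : ∀ t : T, ∑ s : S, prob ![t, t] ![s, s] = 1

namespace ProcessLaw

variable {S : Type u} [Fintype S] {T : Type v} {U : Type w}

/-- The finite-dimensional distributions of a family `X` of `S`-valued random variables on a
probability space `(Ω, P)`. -/
noncomputable def ofProcess {Ω : Type w} [MeasurableSpace Ω] (P : Measure Ω)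
    [IsProbabilityMeasure P] (X : T → Ω → S)
    (hX : ∀ (t : T) (s : S), MeasurableSet {ω | X t ω = s}) : ProcessLaw S T where
  prob {_} t s := P.real {ω | ∀ i, X (t i) ω = s i}
  prob_mem _ _ := ⟨measureReal_nonneg, measureReal_le_one⟩
  prob_sum {k} t := by
    rw [← measureReal_iUnion_fintype]
    · have : (⋃ s : Fin k → S, {ω | ∀ i, X (t i) ω = s i}) = Set.univ := by
        ext ω
        simp only [Set.mem_iUnion, Set.mem_ofPred_eq, Set.mem_univ, iff_true]
        exact ⟨fun i => X (t i) ω, fun _ => rfl⟩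
      rw [this, probReal_univ]
    · intro s s' hs
      refine Set.disjoint_left.2 fun ω h h' => hs (funext fun i => ?_)
      exact (h i).symm.trans (h' i)
    · intro s
      simpa only [Set.ofPred_forall] using MeasurableSet.iInter fun i => hX (t i) (s i)
  prob_marginal {k} t t' s := by
    rw [← measureReal_iUnion_fintype]
    · congr 1
      ext ω
      simp [Fin.forall_fin_succ']
    · intro z z' hz
      refine Set.disjoint_left.2 fun ω h h' => hz ?_
      have h1 := h (Fin.last k)
      have h2 := h' (Fin.last k)
      simp only [Fin.snoc_last] at h1 h2
      exact h1.symm.trans h2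
    · intro z
      simpa only [Set.ofPred_forall] using MeasurableSet.iInter fun i => hX _ _
  prob_perm {k} σ t s := by
    congr 1
    ext ω
    exact σ.forall_congr_right (q := fun i => X (t i) ω = s i)
  prob_diag t := by
    rw [← measureReal_iUnion_fintype]
    · have : (⋃ s : S, {ω | ∀ i, X ((![t, t] : Fin 2 → T) i) ω = (![s, s] : Fin 2 → S) i})
          = Set.univ := by
        ext ω
        simp [Fin.forall_fin_two]
      rw [this, probReal_univ]
    · intro z z' hz
      refine Set.disjoint_left.2 fun ω h h' => hz ?_
      exact (h 0).symm.trans (h' 0)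
    · intro z
      simpa only [Set.ofPred_forall] using MeasurableSet.iInter fun i => hX _ _

/-- `d(t₁, t₂) = 1 - ∑ s, F_{t₁, t₂}(s, s) = P (X t₁ ≠ X t₂)`. -/
noncomputable def d (F : ProcessLaw S T) (t₁ t₂ : T) : ℝ :=
  1 - ∑ s : S, F.prob ![t₁, t₂] ![s, s]

theorem prob_swap (F : ProcessLaw S T) (a b : T) (x y : S) :
    F.prob ![b, a] ![y, x] = F.prob ![a, b] ![x, y] := by
  rw [← F.prob_perm (Equiv.swap 0 1) ![a, b] ![x, y]]
  congr 1 <;> (ext i; fin_cases i <;> simp)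

theorem sum_prob_three (F : ProcessLaw S T) (a b c : T) (x y : S) :
    ∑ z : S, F.prob ![a, b, c] ![x, y, z] = F.prob ![a, b] ![x, y] := by
  rw [← F.prob_marginal ![a, b] c ![x, y]]
  refine Finset.sum_congr rfl fun z _ => ?_
  congr 1 <;> (ext i; fin_cases i <;> rfl)

theorem prob_three_swap (F : ProcessLaw S T) (a b c : T) (x y z : S) :
    F.prob ![a, c, b] ![x, z, y] = F.prob ![a, b, c] ![x, y, z] := by
  rw [← F.prob_perm (Equiv.swap 1 2) ![a, b, c] ![x, y, z]]
  congr 1 <;> (ext i; fin_cases i <;> rfl)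

theorem prob_three_rot (F : ProcessLaw S T) (a b c : T) (x y z : S) :
    F.prob ![b, c, a] ![y, z, x] = F.prob ![a, b, c] ![x, y, z] := by
  rw [← F.prob_perm (finRotate 3) ![a, b, c] ![x, y, z]]
  congr 1 <;> (ext i; fin_cases i <;> rfl)

theorem sum_prob_two (F : ProcessLaw S T) (a b : T) :
    ∑ x : S, ∑ y : S, F.prob ![a, b] ![x, y] = 1 := by
  rw [← F.prob_sum ![a, b], ← Fintype.sum_prod_type']
  exact Fintype.sum_equiv (finTwoArrowEquiv S).symm _ _ fun p => rfl

theorem d_self (F : ProcessLaw S T) (t : T) : F.d t t = 0 := by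
  simp [d, F.prob_diag]

theorem d_comm (F : ProcessLaw S T) (a b : T) : F.d a b = F.d b a := by
  simp only [d, F.prob_swap a b]

theorem d_triangle (F : ProcessLaw S T) (a b c : T) : F.d a c ≤ F.d a b + F.d b c := by
  classical
  set p : S → S → S → ℝ := fun x y z => F.prob ![a, b, c] ![x, y, z] with hp
  have h0 : ∀ x y z, 0 ≤ p x y z := fun x y z => (F.prob_mem _ _).1
  have hab : ∑ s : S, F.prob ![a, b] ![s, s]
      = ∑ x, ∑ y, ∑ z, if x = y then p x y z else 0 := by
    refine Finset.sum_congr rfl fun x _ => ?_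
    rw [Finset.sum_eq_single x (fun y _ hy => by simp [Ne.symm hy]) (by simp)]
    simp [hp, F.sum_prob_three]
  have hac : ∑ s : S, F.prob ![a, c] ![s, s]
      = ∑ x, ∑ y, ∑ z, if x = z then p x y z else 0 := by
    refine Finset.sum_congr rfl fun x _ => ?_
    simp [hp, ← F.sum_prob_three a c b, F.prob_three_swap a b c]
  have hbc : ∑ s : S, F.prob ![b, c] ![s, s]
      = ∑ x, ∑ y, ∑ z, if y = z then p x y z else 0 := by
    rw [Finset.sum_comm]
    refine Finset.sum_congr rfl fun y _ => ?_
    simp [hp, ← F.sum_prob_three b c a, F.prob_three_rot a b c]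
  have h1 : (1 : ℝ) = ∑ x, ∑ y, ∑ z, p x y z := by
    rw [← F.sum_prob_two a b]
    simp [hp, F.sum_prob_three]
  have key : (∑ x, ∑ y, ∑ z, if x = y then p x y z else 0)
      + (∑ x, ∑ y, ∑ z, if y = z then p x y z else 0)
      ≤ (∑ x, ∑ y, ∑ z, p x y z) + ∑ x, ∑ y, ∑ z, if x = z then p x y z else 0 := by
    simp only [← Finset.sum_add_distrib]
    refine Finset.sum_le_sum fun x _ => Finset.sum_le_sum fun y _ => Finset.sum_le_sum fun z _ => ?_
    have := h0 x y z
    split_ifs <;> first | linarith | (subst_vars; contradiction)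
  simp only [d]
  linarith

/-- The distance `d(t₁, t₂) = P (X t₁ ≠ X t₂)` on the index set. -/
@[reducible] noncomputable def pseudoMetric (F : ProcessLaw S T) : PseudoMetricSpace T where
  dist := F.d
  dist_self := F.d_self
  dist_comm := F.d_comm
  dist_triangle := F.d_triangle

/-- `P (X t₁ = X t₂) < 1` for distinct indices, so that `d` is a metric on the index set. -/
def IsNondegenerate (F : ProcessLaw S T) : Prop :=
  ∀ t₁ t₂ : T, t₁ ≠ t₂ → ∑ s : S, F.prob ![t₁, t₂] ![s, s] < 1

/-- The index set with the distance `d` is separable. -/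
def IsSeparable (F : ProcessLaw S T) : Prop :=
  letI := F.pseudoMetric
  TopologicalSpace.SeparableSpace T

/-- The index set with the distance `d` is complete. -/
def IsComplete (F : ProcessLaw S T) : Prop :=
  letI := F.pseudoMetric
  CompleteSpace T

/-- `φ` embeds `(T, F)` in `(U, G)`: the finite-dimensional distributions of `(Y (φ t))` are those of
`(X t)`. -/
def IsEmbedding (F : ProcessLaw S T) (G : ProcessLaw S U) (φ : T → U) : Prop :=
  ∀ (k : ℕ) (t : Fin k → T) (s : Fin k → S), G.prob (φ ∘ t) s = F.prob t s

/-- An isomorphism is an embedding which is onto. -/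
def IsIsomorphism (F : ProcessLaw S T) (G : ProcessLaw S U) (φ : T → U) : Prop :=
  F.IsEmbedding G φ ∧ Function.Surjective φ

/-- The restriction of a process to a subset of its index set. -/
def restrict (F : ProcessLaw S T) (A : Set T) : ProcessLaw S A where
  prob {_} t s := F.prob (fun i => (t i : T)) s
  prob_mem _ _ := F.prob_mem _ _
  prob_sum _ := F.prob_sum _
  prob_marginal {k} t t' s := by
    rw [← F.prob_marginal (fun i => (t i : T)) t' s]
    refine Finset.sum_congr rfl fun z _ => ?_
    congr 1
    ext i
    refine Fin.lastCases ?_ (fun j => ?_) i <;> simp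
  prob_perm σ t s := F.prob_perm σ (fun i => (t i : T)) s
  prob_diag t := by
    rw [← F.prob_diag t]
    refine Finset.sum_congr rfl fun z _ => ?_
    congr 1
    ext i
    fin_cases i <;> rfl

/-- Every finite `S`-valued process embeds in `F`. (Every finite index set is in bijection with one
in `Type`.) -/
def IsUniversal (F : ProcessLaw S T) : Prop :=
  ∀ (V : Type) [Finite V] (G : ProcessLaw S V), ∃ φ : V → T, G.IsEmbedding F φ

/-- Every finite partial isomorphism of `F` to itself extends to an automorphism. -/
def IsUltrahomogeneous (F : ProcessLaw S T) : Prop :=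
  ∀ (A : Set T), A.Finite → ∀ φ : A → T, (F.restrict A).IsEmbedding F φ →
    ∃ g : T → T, F.IsIsomorphism F g ∧ ∀ a : A, g a = φ a

end ProcessLaw

namespace ProcessLaw

/-! The model is the set of measurable maps from $[0,1]$ with Lebesgue measure to `S`, modulo a.e.
equality, so that `d` is the measure of the set of disagreement. What carries everything is the
one-point extension property `RealizesExtensions`. Lebesgue measure has no atoms, so each event on
which finitely many variables take given values can be cut into pieces of prescribed masses; this
produces a further variable with any compatible joint law (`ofProcess_realizesExtensions`).

Iterating extensions from the empty tuple gives universality. Between two complete separable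
processes that extend each other, back-and-forth along dense sequences yields a matching with dense
projections. Laws are continuous in the indices, so its closure is still a matching; completeness
makes it total on both sides and nondegeneracy makes it a function
(`IsMatching.exists_isIsomorphism`). Applied to a process and itself, this is ultrahomogeneity.
Uniqueness follows because universality and ultrahomogeneity of a nondegenerate process give back
the extension property (`IsUltrahomogeneous.realizesExtensions`). -/

theorem append_comp_self {α : Type*} {k m : ℕ} (r : Fin m → Fin k) (f : Fin k → α) :
    Fin.append (f ∘ r) f = f ∘ Fin.append r id := by
  ext i
  refine Fin.addCases (fun i => ?_) (fun i => ?_) i <;> simp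

theorem append_comp_natAdd {α : Type*} {k m : ℕ} (f : Fin k → α) (g : Fin m → α) :
    Fin.append f g ∘ Fin.natAdd k = g :=
  funext fun i => Fin.append_right f g i

variable {S : Type u} [Fintype S] {T : Type v} {U : Type w}

/-! ### Reindexing of tuples, and continuity of the laws in the indices -/

section Reindexing

variable (F : ProcessLaw S T)

theorem prob_nonneg {k : ℕ} (t : Fin k → T) (s : Fin k → S) : 0 ≤ F.prob t s :=
  (F.prob_mem t s).1

theorem prob_comp_bijective {k m : ℕ} {e : Fin m → Fin k} (he : Function.Bijective e)
    (t : Fin k → T) (x : Fin k → S) : F.prob (t ∘ e) (x ∘ e) = F.prob t x := by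
  obtain rfl : m = k := by simpa using Fintype.card_of_bijective he
  exact F.prob_perm (Equiv.ofBijective e he) t x

theorem prob_snoc_le {k : ℕ} (t : Fin k → T) (t' : T) (x : Fin k → S) (z : S) :
    F.prob (Fin.snoc t t' : Fin (k + 1) → T) (Fin.snoc x z : Fin (k + 1) → S) ≤ F.prob t x := by
  rw [← F.prob_marginal t t' x]
  exact Finset.single_le_sum
    (f := fun z => F.prob (Fin.snoc t t' : Fin (k + 1) → T) (Fin.snoc x z : Fin (k + 1) → S))
    (fun _ _ => F.prob_nonneg _ _) (Finset.mem_univ z)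

/-- A finite-dimensional distribution is dominated by its marginals. -/
theorem prob_le_prob_comp {k m : ℕ} {e : Fin m → Fin k} (he : Function.Injective e)
    (t : Fin k → T) (x : Fin k → S) : F.prob t x ≤ F.prob (t ∘ e) (x ∘ e) := by
  -- The induction adjoins to `e` one missed index at a time, until it is a bijection.
  induction hn : k - m generalizing m with
  | zero =>
    have hmk : m ≤ k := by simpa using Fintype.card_le_of_injective e he
    have : Function.Bijective e :=
      (Fintype.bijective_iff_injective_and_card e).2 ⟨he, by simp; omega⟩
    exact (F.prob_comp_bijective this t x).ge
  | succ n ih =>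
    obtain ⟨j, hj⟩ : ∃ j, j ∉ Set.range e := by
      by_contra! h
      have := Fintype.card_le_of_surjective e h
      simp at this
      omega
    have h := ih (e := Fin.snoc e j) (Fin.snoc_injective_iff.2 ⟨he, hj⟩) (by omega)
    rw [Fin.comp_snoc, Fin.comp_snoc] at h
    exact h.trans (F.prob_snoc_le _ _ _ _)

theorem prob_le_prob_pair {k : ℕ} {i j : Fin k} (hij : i ≠ j) (t : Fin k → T) (x : Fin k → S) :
    F.prob t x ≤ F.prob ![t i, t j] ![x i, x j] := by
  have h := F.prob_le_prob_comp (e := ![i, j])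
    (by
      intro a b
      fin_cases a <;> fin_cases b <;> simp [hij, hij.symm]) t x
  convert h using 2 <;> (ext l; fin_cases l <;> rfl)

/-- The diagonal and the pair `(x, y)` are disjoint parts of a total mass 1. -/
theorem prob_pair_le_d (a b : T) {x y : S} (hxy : x ≠ y) : F.prob ![a, b] ![x, y] ≤ F.d a b := by
  classical
  have h1 : ∑ s : S, F.prob ![a, b] ![s, s] + F.prob ![a, b] ![x, y]
      ≤ ∑ x : S, ∑ y : S, F.prob ![a, b] ![x, y] := by
    rw [← Fintype.sum_prod_type', ← Finset.sum_image (s := Finset.univ) (g := fun s : S => (s, s))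
      (f := fun p : S × S => F.prob ![a, b] ![p.1, p.2]) (by simp [Set.InjOn]),
      add_comm, ← Finset.sum_insert (a := (x, y))
      (f := fun p : S × S => F.prob ![a, b] ![p.1, p.2]) (by simp; grind)]
    exact Finset.sum_le_sum_of_subset_of_nonneg (Finset.subset_univ _)
      fun _ _ _ => F.prob_nonneg _ _
  rw [F.sum_prob_two] at h1
  rw [d]
  linarith

theorem prob_le_d {k : ℕ} (i j : Fin k) (t : Fin k → T) {x : Fin k → S} (hx : x i ≠ x j) :
    F.prob t x ≤ F.d (t i) (t j) :=
  (F.prob_le_prob_pair (fun h => hx (congrArg x h)) t x).trans (F.prob_pair_le_d _ _ hx)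

theorem d_nonneg (a b : T) : 0 ≤ F.d a b := by
  let _ := F.pseudoMetric
  exact dist_nonneg (x := a) (y := b)

theorem prob_eq_zero {k : ℕ} {i j : Fin k} {t : Fin k → T} (ht : t i = t j) {x : Fin k → S}
    (hx : x i ≠ x j) : F.prob t x = 0 := by
  refine le_antisymm ((F.prob_le_d i j t hx).trans ?_) (F.prob_nonneg _ _)
  rw [ht, F.d_self]

/-- Restricting along a section of `r` gives `≤` termwise. Both sides sum to 1, because states not
constant on the fibres of `r` have probability zero; hence all terms agree. -/
theorem prob_comp_surjective {k m : ℕ} {r : Fin m → Fin k} (hr : Function.Surjective r)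
    (t : Fin k → T) (x : Fin k → S) : F.prob (t ∘ r) (x ∘ r) = F.prob t x := by
  classical
  obtain ⟨q, hq⟩ := hr.hasRightInverse
  have hrq : r ∘ q = id := funext hq
  have hle : ∀ x : Fin k → S, F.prob (t ∘ r) (x ∘ r) ≤ F.prob t x := fun x => by
    have h := F.prob_le_prob_comp hq.injective (t ∘ r) (x ∘ r)
    rwa [Function.comp_assoc, Function.comp_assoc, hrq, Function.comp_id, Function.comp_id] at h
  have hsum : ∑ x : Fin k → S, F.prob (t ∘ r) (x ∘ r) = ∑ x : Fin k → S, F.prob t x := by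
    rw [F.prob_sum t, ← F.prob_sum (t ∘ r), ← Finset.sum_image (s := Finset.univ)
      (g := fun x : Fin k → S => x ∘ r) (f := fun y => F.prob (t ∘ r) y)
      hr.injective_comp_right.injOn]
    refine Finset.sum_subset (Finset.subset_univ _) fun y _ hy => ?_
    by_contra h0
    refine hy (Finset.mem_image.2 ⟨y ∘ q, Finset.mem_univ _, funext fun i => ?_⟩)
    by_contra hi
    exact h0 (F.prob_eq_zero (i := q (r i)) (j := i) (by simp [hq (r i)]) hi)
  exact (Finset.sum_eq_sum_iff_of_le fun x _ => hle x).1 hsum x (Finset.mem_univ x)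

theorem sum_prob_append {k m : ℕ} (t : Fin k → T) (t' : Fin m → T) (x : Fin k → S) :
    ∑ y : Fin m → S, F.prob (Fin.append t t') (Fin.append x y) = F.prob t x := by
  induction m with
  | zero =>
    rw [Fintype.sum_unique, Fin.append_right_nil _ _ rfl, Fin.append_right_nil _ _ rfl]
    rfl
  | succ m ih =>
    rw [← Equiv.sum_comp (Fin.snocEquiv fun _ => S), Fintype.sum_prod_type_right, ← ih (Fin.init t')]
    refine Finset.sum_congr rfl fun y _ => ?_
    rw [← F.prob_marginal _ (t' (Fin.last m))]
    refine Finset.sum_congr rfl fun z _ => ?_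
    rw [← Fin.append_snoc, ← Fin.append_snoc, Fin.snoc_init_self]
    rfl

/-- The distribution along a reindexed tuple is the pushforward of the original one. -/
theorem prob_comp {k m : ℕ} (r : Fin m → Fin k) (t : Fin k → T) (y : Fin m → S) [DecidableEq S] :
    F.prob (t ∘ r) y = ∑ x : Fin k → S, if x ∘ r = y then F.prob t x else 0 := by
  rw [← F.sum_prob_append (t ∘ r) t y]
  refine Finset.sum_congr rfl fun x _ => ?_
  split_ifs with h
  · subst h
    rw [append_comp_self, append_comp_self]
    exact F.prob_comp_surjective (fun i => ⟨Fin.natAdd m i, by simp⟩) t x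
  · obtain ⟨i, hi⟩ := Function.ne_iff.1 h
    exact F.prob_eq_zero (i := Fin.natAdd m (r i)) (j := Fin.castAdd k i) (by simp) (by simpa using hi)

theorem prob_comp_congr {F : ProcessLaw S T} {G : ProcessLaw S U} {k m : ℕ} {t : Fin k → T}
    {t' : Fin k → U} (h : ∀ x, F.prob t x = G.prob t' x) (r : Fin m → Fin k) (y : Fin m → S) :
    F.prob (t ∘ r) y = G.prob (t' ∘ r) y := by
  classical
  simp only [prob_comp, h]

theorem d_congr {F : ProcessLaw S T} {G : ProcessLaw S U} {a b : T} {a' b' : U}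
    (h : ∀ x, F.prob ![a, b] x = G.prob ![a', b'] x) : F.d a b = G.d a' b' := by
  simp only [d, h]

/-- In the joint law of `t` and `t'`, states `y ≠ x` of `t'` force a disagreement at some
coordinate, so each costs at most the sum of the distances; the cardinality counts the `y`. -/
theorem prob_sub_le {k : ℕ} (t t' : Fin k → T) (x : Fin k → S) :
    F.prob t x ≤ F.prob t' x + Fintype.card (Fin k → S) * ∑ i, F.d (t i) (t' i) := by
  classical
  have hle : F.prob (Fin.append t t') (Fin.append x x) ≤ F.prob t' x := by
    have h := F.prob_le_prob_comp (e := Fin.natAdd k) (Fin.natAdd_injective k k)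
      (Fin.append t t') (Fin.append x x)
    rwa [append_comp_natAdd, append_comp_natAdd] at h
  have hnn : 0 ≤ ∑ i, F.d (t i) (t' i) := Finset.sum_nonneg fun i _ => F.d_nonneg _ _
  have hy : ∀ y : Fin k → S, F.prob (Fin.append t t') (Fin.append x y)
      ≤ (if y = x then F.prob t' x else 0) + ∑ i, F.d (t i) (t' i) := fun y => by
    split_ifs with h
    · subst h
      linarith
    · obtain ⟨i, hi⟩ := Function.ne_iff.1 h
      have h1 := F.prob_le_d (Fin.castAdd k i) (Fin.natAdd k i) (Fin.append t t')
        (x := Fin.append x y) (by rw [Fin.append_left, Fin.append_right]; exact hi.symm)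
      rw [Fin.append_left, Fin.append_right] at h1
      have h2 := Finset.single_le_sum (f := fun i => F.d (t i) (t' i))
        (fun i _ => F.d_nonneg _ _) (Finset.mem_univ i)
      linarith
  calc F.prob t x = ∑ y : Fin k → S, F.prob (Fin.append t t') (Fin.append x y) :=
        (F.sum_prob_append t t' x).symm
    _ ≤ ∑ y : Fin k → S, ((if y = x then F.prob t' x else 0) + ∑ i, F.d (t i) (t' i)) :=
        Finset.sum_le_sum fun y _ => hy y
    _ = _ := by
      rw [Finset.sum_add_distrib]
      simp

/-- The finite-dimensional distributions depend continuously on the tuple of indices. -/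
theorem continuous_prob {k : ℕ} (x : Fin k → S) :
    letI := F.pseudoMetric
    Continuous fun t : Fin k → T => F.prob t x := by
  let _ := F.pseudoMetric
  have hd : ∀ a b, F.d a b = dist a b := fun _ _ => rfl
  rw [continuous_iff_continuousAt]
  intro t
  have hlim : Filter.Tendsto
      (fun t' : Fin k → T => (Fintype.card (Fin k → S) : ℝ) * ∑ i, dist (t' i) (t i))
      (nhds t) (nhds 0) := by
    have hcont : Continuous
        (fun t' : Fin k → T => (Fintype.card (Fin k → S) : ℝ) * ∑ i, dist (t' i) (t i)) := by
      fun_prop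
    simpa using hcont.tendsto t
  refine tendsto_iff_dist_tendsto_zero.2 (squeeze_zero (fun _ => dist_nonneg) (fun t' => ?_) hlim)
  rw [Real.dist_eq, abs_le]
  have h1 := F.prob_sub_le t t' x
  have h2 := F.prob_sub_le t' t x
  simp only [F.d_comm (t _) (t' _)] at h1
  simp only [hd] at h1 h2
  constructor <;> linarith

end Reindexing

theorem comp_pair {α β : Type*} (f : α → β) (a b : α) : f ∘ ![a, b] = ![f a, f b] := by
  ext i
  fin_cases i <;> rfl

/-- The process `(X (f v))`. -/
def comap (F : ProcessLaw S T) (f : U → T) : ProcessLaw S U where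
  prob {_} v s := F.prob (f ∘ v) s
  prob_mem _ _ := F.prob_mem _ _
  prob_sum _ := F.prob_sum _
  prob_marginal v v' s := by
    simp only [Fin.comp_snoc]
    exact F.prob_marginal _ _ s
  prob_perm σ v s := F.prob_perm σ (f ∘ v) s
  prob_diag v := by
    simp only [comp_pair]
    exact F.prob_diag _

/-! ### Back-and-forth, and its converse for ultrahomogeneous processes -/

section BackAndForth

/-- One-point extensions in `G` of a tuple of `G` can be copied in `F`. -/
def RealizesExtensions (F : ProcessLaw S T) (G : ProcessLaw S U) : Prop :=
  ∀ (k : ℕ) (t : Fin k → T) (u : Fin k → U), (∀ x, F.prob t x = G.prob u x) → ∀ u' : U,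
    ∃ t' : T, ∀ x, F.prob (Fin.snoc t t' : Fin (k + 1) → T) x
      = G.prob (Fin.snoc u u' : Fin (k + 1) → U) x

/-- A relation between index sets all of whose finite tuples have the same distributions on both
sides. -/
def IsMatching (F : ProcessLaw S T) (G : ProcessLaw S U) (R : Set (T × U)) : Prop :=
  ∀ (m : ℕ) (p : Fin m → T × U), (∀ i, p i ∈ R) →
    ∀ x, F.prob (Prod.fst ∘ p) x = G.prob (Prod.snd ∘ p) x

variable {F : ProcessLaw S T} {G : ProcessLaw S U}

/-- A tuple drawn from the range of `p` is a reindexing of `p`, so one equality of laws suffices. -/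
theorem isMatching_range {k : ℕ} {p : Fin k → T × U}
    (h : ∀ x, F.prob (Prod.fst ∘ p) x = G.prob (Prod.snd ∘ p) x) :
    F.IsMatching G (Set.range p) := by
  intro m q hq
  choose r hr using hq
  obtain rfl : q = p ∘ r := funext fun i => (hr i).symm
  exact prob_comp_congr h r

theorem prob_zero_eq_one (F : ProcessLaw S T) (t : Fin 0 → T) (x : Fin 0 → S) : F.prob t x = 1 := by
  have h := F.prob_sum t
  rwa [Fintype.sum_unique, Subsingleton.elim default x] at h

theorem isMatching_empty (F : ProcessLaw S T) (G : ProcessLaw S U) :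
    F.IsMatching G ↑(∅ : Finset (T × U)) := by
  rintro (_ | m) p hp x
  · rw [prob_zero_eq_one, prob_zero_eq_one]
  · simpa using hp 0

theorem exists_range_eq_finset {α : Type*} (R : Finset α) :
    ∃ p : Fin R.card → α, Set.range p = R := by
  refine ⟨fun i => R.equivFin.symm i, ?_⟩
  rw [Set.range_comp' Subtype.val R.equivFin.symm, R.equivFin.symm.range_eq_univ]
  simp

theorem IsMatching.exists_insert_left {R : Finset (T × U)} (hR : F.IsMatching G R)
    (hext : G.RealizesExtensions F) (a : T) : ∃ b : U, F.IsMatching G (insert (a, b) (R : Set _)) := by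
  obtain ⟨p, hp⟩ := exists_range_eq_finset R
  obtain ⟨b, hb⟩ := hext _ (Prod.snd ∘ p) (Prod.fst ∘ p)
    (fun x => (hR _ p (fun i => hp ▸ Set.mem_range_self i) x).symm) a
  refine ⟨b, ?_⟩
  rw [← hp, ← Fin.range_snoc]
  refine isMatching_range fun x => ?_
  rw [Fin.comp_snoc, Fin.comp_snoc]
  exact (hb x).symm

theorem IsMatching.exists_insert_right {R : Finset (T × U)} (hR : F.IsMatching G R)
    (hext : F.RealizesExtensions G) (b : U) : ∃ a : T, F.IsMatching G (insert (a, b) (R : Set _)) := by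
  obtain ⟨p, hp⟩ := exists_range_eq_finset R
  obtain ⟨a, ha⟩ := hext _ (Prod.fst ∘ p) (Prod.snd ∘ p)
    (fun x => hR _ p (fun i => hp ▸ Set.mem_range_self i) x) b
  refine ⟨a, ?_⟩
  rw [← hp, ← Fin.range_snoc]
  refine isMatching_range fun x => ?_
  rw [Fin.comp_snoc, Fin.comp_snoc]
  exact ha x

/-- The back-and-forth construction. -/
theorem IsMatching.exists_extension (hFG : F.RealizesExtensions G) (hGF : G.RealizesExtensions F)
    {R₀ : Finset (T × U)} (h₀ : F.IsMatching G R₀) (a : ℕ → T) (b : ℕ → U) :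
    ∃ R : Set (T × U), F.IsMatching G R ∧ (R₀ : Set _) ⊆ R ∧
      (∀ n, a n ∈ Prod.fst '' R) ∧ ∀ n, b n ∈ Prod.snd '' R := by
  classical
  -- Finite matchings ordered by inclusion; each requirement to meet `a n` or `b n` is cofinal, and
  -- the union of an ideal meeting all of them is taken.
  let P := {R : Finset (T × U) // F.IsMatching G R}
  let 𝒟 : ℕ ⊕ ℕ → Order.Cofinal P := Sum.elim
    (fun n => ⟨{R | a n ∈ Prod.fst '' (R.1 : Set (T × U))}, fun R => by
      obtain ⟨y, hy⟩ := R.2.exists_insert_left hGF (a n)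
      rw [← Finset.coe_insert] at hy
      exact ⟨⟨_, hy⟩, ⟨(a n, y), by simp, rfl⟩, Finset.subset_insert _ _⟩⟩)
    (fun n => ⟨{R | b n ∈ Prod.snd '' (R.1 : Set (T × U))}, fun R => by
      obtain ⟨y, hy⟩ := R.2.exists_insert_right hFG (b n)
      rw [← Finset.coe_insert] at hy
      exact ⟨⟨_, hy⟩, ⟨(y, b n), by simp, rfl⟩, Finset.subset_insert _ _⟩⟩)
  let I := Order.idealOfCofinals (⟨R₀, h₀⟩ : P) 𝒟
  -- By directedness, finitely many pairs of the union lie in a single finite matching.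
  have hI : ∀ (m : ℕ) (p : Fin m → T × U), (∀ i, ∃ R ∈ I, p i ∈ R.1) →
      ∃ R ∈ I, ∀ i, p i ∈ R.1 := by
    intro m
    induction m with
    | zero => exact fun p _ => ⟨_, Order.mem_idealOfCofinals (⟨R₀, h₀⟩ : P) 𝒟, fun i => i.elim0⟩
    | succ m ih =>
      intro p hp
      obtain ⟨R, hR, h⟩ := ih (p ∘ Fin.castSucc) fun i => hp _
      obtain ⟨R', hR', h'⟩ := hp (Fin.last m)
      obtain ⟨R'', hR'', h1, h2⟩ := I.directed _ hR _ hR'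
      exact ⟨R'', hR'', Fin.lastCases (h2 h') fun i => h1 (h i)⟩
  refine ⟨⋃ R ∈ I, (R.1 : Set (T × U)), ?_, ?_, fun n => ?_, fun n => ?_⟩
  · intro m p hp
    obtain ⟨R, -, hR⟩ := hI m p fun i => by simpa using hp i
    exact R.2 m p hR
  · exact Set.subset_biUnion_of_mem (u := fun R : P => (R.1 : Set (T × U)))
      (Order.mem_idealOfCofinals (⟨R₀, h₀⟩ : P) 𝒟)
  · obtain ⟨R, hR, hRI⟩ := Order.cofinal_meets_idealOfCofinals (⟨R₀, h₀⟩ : P) 𝒟 (Sum.inl n)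
    exact Set.image_mono (Set.subset_biUnion_of_mem (u := fun R : P => (R.1 : Set (T × U))) hRI) hR
  · obtain ⟨R, hR, hRI⟩ := Order.cofinal_meets_idealOfCofinals (⟨R₀, h₀⟩ : P) 𝒟 (Sum.inr n)
    exact Set.image_mono (Set.subset_biUnion_of_mem (u := fun R : P => (R.1 : Set (T × U))) hRI) hR

theorem IsMatching.d_eq {R : Set (T × U)} (hR : F.IsMatching G R) {p q : T × U} (hp : p ∈ R)
    (hq : q ∈ R) : F.d p.1 q.1 = G.d p.2 q.2 := by
  refine d_congr fun x => ?_
  have h := hR 2 ![p, q] (Fin.forall_fin_two.2 ⟨hp, hq⟩) x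
  rwa [comp_pair, comp_pair] at h

theorem IsMatching.closure {R : Set (T × U)} (hR : F.IsMatching G R) :
    letI := F.pseudoMetric
    letI := G.pseudoMetric
    F.IsMatching G (_root_.closure R) := by
  let _ := F.pseudoMetric
  let _ := G.pseudoMetric
  intro m p hp x
  have hclosed : IsClosed {p : Fin m → T × U | F.prob (Prod.fst ∘ p) x = G.prob (Prod.snd ∘ p) x} :=
    isClosed_eq ((F.continuous_prob x).comp (by fun_prop)) ((G.continuous_prob x).comp (by fun_prop))
  have hsub := hclosed.closure_subset_iff.2
    (fun p hp => hR m p (fun i => hp i (Set.mem_univ i)) x :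
      Set.univ.pi (fun _ : Fin m => R) ⊆ _)
  rw [closure_pi_set] at hsub
  exact hsub fun i _ => hp i

/-- Partners of a sequence converging to `t` form a Cauchy sequence, since a matching preserves `d`.
-/
theorem IsMatching.exists_closure_left {R : Set (T × U)} (hR : F.IsMatching G R)
    (hG : G.IsComplete) (t : T) :
    letI := F.pseudoMetric
    letI := G.pseudoMetric
    Dense (Prod.fst '' R) → ∃ u, (t, u) ∈ _root_.closure R := by
  let _ := F.pseudoMetric
  let _ := G.pseudoMetric
  have : CompleteSpace U := hG
  intro hd
  obtain ⟨a, ha, hat⟩ := mem_closure_iff_seq_limit.1 (hd t)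
  choose p hpR hpa using ha
  obtain rfl : Prod.fst ∘ p = a := funext hpa
  have hc : CauchySeq (Prod.snd ∘ p) := by
    rw [Metric.cauchySeq_iff]
    intro ε hε
    obtain ⟨N, hN⟩ := Metric.cauchySeq_iff.1 hat.cauchySeq ε hε
    refine ⟨N, fun m hm n hn => ?_⟩
    exact (hR.d_eq (hpR m) (hpR n)).ge.trans_lt (hN m hm n hn)
  obtain ⟨u, hu⟩ := cauchySeq_tendsto_of_complete hc
  exact ⟨u, mem_closure_of_tendsto (hat.prodMk_nhds hu) (Filter.Eventually.of_forall hpR)⟩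

theorem IsMatching.swap {R : Set (T × U)} (hR : F.IsMatching G R) :
    G.IsMatching F (Prod.swap ⁻¹' R) :=
  fun m p hp x => (hR m (Prod.swap ∘ p) hp x).symm

theorem IsNondegenerate.eq_of_d_eq_zero (hF : F.IsNondegenerate) {a b : T} (h : F.d a b = 0) :
    a = b := by
  by_contra hab
  have := hF a b hab
  rw [d] at h
  linarith

/-- Finite partial isomorphisms between complete separable processes which realize each other's
one-point extensions extend to isomorphisms. -/
theorem IsMatching.exists_isIsomorphism (hFG : F.RealizesExtensions G)
    (hGF : G.RealizesExtensions F) (hGn : G.IsNondegenerate)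
    (hFs : F.IsSeparable) (hGs : G.IsSeparable) (hFc : F.IsComplete) (hGc : G.IsComplete)
    {R₀ : Finset (T × U)} (h₀ : F.IsMatching G R₀) :
    ∃ g : T → U, F.IsIsomorphism G g ∧ ∀ p ∈ R₀, g p.1 = p.2 := by
  let _ := F.pseudoMetric
  let _ := G.pseudoMetric
  have : TopologicalSpace.SeparableSpace T := hFs
  have : TopologicalSpace.SeparableSpace U := hGs
  -- Dense sequences exist only in nonempty spaces.
  rcases isEmpty_or_nonempty T with hT | ⟨⟨t₀⟩⟩
  · have hU : IsEmpty U := ⟨fun u => by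
      obtain ⟨t, -⟩ := hFG 0 Fin.elim0 Fin.elim0 (fun x => by
        rw [prob_zero_eq_one, prob_zero_eq_one]) u
      exact hT.elim t⟩
    refine ⟨fun t => hT.elim t, ⟨fun k t s => ?_, fun u => hU.elim u⟩, fun p => hT.elim p.1⟩
    rcases k with _ | k
    · rw [prob_zero_eq_one, prob_zero_eq_one]
    · exact hT.elim (t 0)
  have : Nonempty T := ⟨t₀⟩
  have : Nonempty U := by
    obtain ⟨u, -⟩ := h₀.exists_insert_left hGF t₀
    exact ⟨u⟩
  obtain ⟨R, hR, hR₀, ha, hb⟩ := h₀.exists_extension hFG hGF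
    (TopologicalSpace.denseSeq T) (TopologicalSpace.denseSeq U)
  have hl : ∀ t, ∃ u, (t, u) ∈ _root_.closure R := fun t => hR.exists_closure_left hGc t
    ((TopologicalSpace.denseRange_denseSeq T).mono (Set.range_subset_iff.2 ha))
  have hr : ∀ u, ∃ t, (t, u) ∈ _root_.closure R := fun u => by
    obtain ⟨t, ht⟩ := hR.swap.exists_closure_left hFc u
      ((TopologicalSpace.denseRange_denseSeq U).mono (Set.range_subset_iff.2 fun n => by
        obtain ⟨p, hp, h⟩ := hb n
        exact ⟨p.swap, by simpa using hp, h⟩))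
    exact ⟨t, (closure_minimal (Set.preimage_mono subset_closure)
      (isClosed_closure.preimage continuous_swap) ht :)⟩
  have hfun : ∀ t u u', (t, u) ∈ _root_.closure R → (t, u') ∈ _root_.closure R → u = u' :=
    fun t u u' h h' => hGn.eq_of_d_eq_zero (by rw [← hR.closure.d_eq h h', F.d_self])
  choose g hg using hl
  refine ⟨g, ⟨fun k t s => ?_, fun u => ?_⟩, fun p hp => ?_⟩
  · exact (hR.closure k (fun i => (t i, g (t i))) (fun i => hg _) s).symm
  · obtain ⟨t, ht⟩ := hr u
    exact ⟨t, hfun t _ _ (hg t) ht⟩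
  · exact hfun p.1 _ _ (hg _) (subset_closure (hR₀ hp))

/-- Universality provides a copy of `(u, u')` somewhere in `F`; an automorphism carries its first
`k` points to `t`, and its last point to the required `t'`. -/
theorem IsUltrahomogeneous.realizesExtensions (hF : F.IsUltrahomogeneous) (hu : F.IsUniversal)
    (hn : F.IsNondegenerate) (G : ProcessLaw S U) : F.RealizesExtensions G := by
  intro k t u htu u'
  obtain ⟨ψ, hψ⟩ := hu (Fin (k + 1)) (G.comap (Fin.snoc u u'))
  have hψu : ∀ x, F.prob (ψ ∘ Fin.castSucc) x = G.prob u x := fun x => by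
    rw [hψ k Fin.castSucc x]
    change G.prob ((Fin.snoc u u' : Fin (k + 1) → U) ∘ Fin.castSucc) x = _
    rw [Fin.snoc_comp_castSucc]
  have hψt : ∀ x, F.prob (ψ ∘ Fin.castSucc) x = F.prob t x := fun x => by rw [hψu, htu]
  -- The copied points may coincide, so `i` only picks one position for each of them.
  choose i hi using fun a : Set.range (ψ ∘ Fin.castSucc : Fin k → T) => a.2
  obtain ⟨g, ⟨hg, -⟩, hga⟩ := hF (Set.range (ψ ∘ Fin.castSucc)) (Set.finite_range _) (t ∘ i)
    (fun m a s => by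
      change F.prob (t ∘ (i ∘ a)) s = F.prob (fun j => (a j : T)) s
      rw [← prob_comp_congr hψt]
      congr 1
      funext j
      exact hi (a j))
  have hgt : g ∘ ψ ∘ Fin.castSucc = t := by
    funext j
    have h := hga ⟨_, Set.mem_range_self j⟩
    refine h.trans (hn.eq_of_d_eq_zero ?_)
    set l := i ⟨_, Set.mem_range_self j⟩ with hl
    have h2 : (ψ ∘ Fin.castSucc) l = (ψ ∘ Fin.castSucc) j := hi ⟨_, Set.mem_range_self j⟩
    -- The positions `l` and `j` hold the same copied point; equality of laws puts `t l` and `t j`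
    -- at distance 0.
    have h3 : F.d ((ψ ∘ Fin.castSucc) l) ((ψ ∘ Fin.castSucc) j) = F.d (t l) (t j) :=
      d_congr fun x => by
        have := prob_comp_congr hψt ![l, j] x
        simpa only [comp_pair] using this
    rw [Function.comp_apply, ← hl, ← h3, h2, F.d_self]
  refine ⟨g (ψ (Fin.last k)), fun x => ?_⟩
  have hs : (Fin.snoc t (g (ψ (Fin.last k))) : Fin (k + 1) → T) = g ∘ (ψ ∘ id) := by
    rw [← hgt]
    funext j
    refine Fin.lastCases ?_ (fun j => ?_) j <;> simp
  rw [hs, hg, hψ]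
  rfl

theorem exists_prob_eq_of_realizesExtensions (h : F.RealizesExtensions G) {n : ℕ} (u : Fin n → U) :
    ∃ t : Fin n → T, ∀ x, F.prob t x = G.prob u x := by
  induction n with
  | zero =>
    exact ⟨Fin.elim0, fun x => by rw [prob_zero_eq_one, prob_zero_eq_one]⟩
  | succ n ih =>
    obtain ⟨t, ht⟩ := ih (Fin.init u)
    obtain ⟨t', ht'⟩ := h n t _ ht (u (Fin.last n))
    rw [Fin.snoc_init_self] at ht'
    exact ⟨_, ht'⟩

theorem isUniversal_of_realizesExtensions
    (h : ∀ (V : Type) (G : ProcessLaw S V), F.RealizesExtensions G) : F.IsUniversal := by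
  intro V _ G
  obtain ⟨n, ⟨e⟩⟩ := Finite.exists_equiv_fin V
  obtain ⟨t, ht⟩ := exists_prob_eq_of_realizesExtensions (h V G) e.symm
  refine ⟨t ∘ e, fun k v s => ?_⟩
  rw [Function.comp_assoc, prob_comp_congr ht, ← Function.comp_assoc, e.symm_comp_self,
    Function.id_comp]

theorem isUltrahomogeneous_of_realizesExtensions (h : F.RealizesExtensions F)
    (hn : F.IsNondegenerate) (hs : F.IsSeparable) (hc : F.IsComplete) : F.IsUltrahomogeneous := by
  classical
  intro A hA φ hφ
  have := hA.fintype
  obtain ⟨g, hg, hgA⟩ := IsMatching.exists_isIsomorphism (F := F) (G := F) h h hn hs hs hc hc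
    (R₀ := Finset.univ.image fun a : A => ((a : T), φ a)) (fun m p hp x => by
      have hp' : ∀ i, ∃ a : A, ((a : T), φ a) = p i := fun i => by simpa using hp i
      choose a ha using hp'
      obtain rfl : (fun i => ((a i : T), φ (a i))) = p := funext ha
      exact (hφ m a x).symm)
  exact ⟨g, hg, fun a => hgA (a, φ a) (Finset.mem_image_of_mem _ (Finset.mem_univ a))⟩

end BackAndForth

/-! ### Completeness, separability and extensions for random variables -/

section RandomVariables

variable {Ω : Type*} [MeasurableSpace Ω]

theorem measurableSet_eq_of_states {f g : Ω → S} (hf : ∀ s, MeasurableSet {ω | f ω = s})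
    (hg : ∀ s, MeasurableSet {ω | g ω = s}) : MeasurableSet {ω | f ω = g ω} := by
  have : {ω | f ω = g ω} = ⋃ s : S, {ω | f ω = s} ∩ {ω | g ω = s} := by
    ext ω
    simp [eq_comm]
  rw [this]
  exact MeasurableSet.iUnion fun s => (hf s).inter (hg s)

variable {P : Measure Ω} [IsProbabilityMeasure P] {X : T → Ω → S}
  (hX : ∀ (t : T) (s : S), MeasurableSet {ω | X t ω = s})

theorem ofProcess_d (a b : T) : (ofProcess P X hX).d a b = P.real {ω | X a ω ≠ X b ω} := by
  have hsum : ∑ s : S, (ofProcess P X hX).prob ![a, b] ![s, s] = P.real {ω | X a ω = X b ω} := by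
    change ∑ s : S, P.real {ω | ∀ i, X ((![a, b] : Fin 2 → T) i) ω = (![s, s] : Fin 2 → S) i} = _
    rw [← measureReal_iUnion_fintype]
    · congr 1
      ext ω
      simp [Fin.forall_fin_two, eq_comm]
    · intro z z' hz
      exact Set.disjoint_left.2 fun ω h h' => hz ((h 0).symm.trans (h' 0))
    · intro z
      simpa only [Set.ofPred_forall] using MeasurableSet.iInter fun i => hX _ _
  rw [d, hsum, ← probReal_compl_eq_one_sub (measurableSet_eq_of_states (hX a) (hX b))]
  rfl

theorem ofProcess_isNondegenerate (hinj : ∀ a b, X a =ᵐ[P] X b → a = b) :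
    (ofProcess P X hX).IsNondegenerate := by
  intro a b hab
  by_contra! h
  refine hab (hinj a b ?_)
  have h1 := (ofProcess P X hX).d_nonneg a b
  have h0 : (ofProcess P X hX).d a b = 0 := le_antisymm (by rw [d]; linarith) h1
  rw [ofProcess_d, measureReal_eq_zero_iff] at h0
  exact h0

/-- The level sets of each variable are approximated from a countable measure-dense family;
variables with the same approximants are close. -/
theorem ofProcess_isSeparable [MeasureTheory.IsSeparable P] : (ofProcess P X hX).IsSeparable := by
  let _ := (ofProcess P X hX).pseudoMetric
  obtain ⟨𝒜, hc, hd⟩ := exists_countable_measureDense P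
  have := hc.to_subtype
  suffices SecondCountableTopology T from inferInstanceAs (TopologicalSpace.SeparableSpace T)
  refine Metric.secondCountable_of_countable_discretization fun ε hε => ?_
  -- Each state contributes two symmetric differences; the `+ 1` covers empty `S`.
  have hδ : 0 < ε / (2 * (Fintype.card S + 1)) := by positivity
  choose A hA hPA using fun (t : T) (s : S) => hd.approx _ (hX t s) (measure_ne_top P _) _ hδ
  refine ⟨S → 𝒜, Encodable.ofCountable _, fun t s => ⟨A t s, hA t s⟩, fun x y hxy => ?_⟩
  have hAxy : ∀ s, A x s = A y s := fun s => congrArg Subtype.val (congrFun hxy s)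
  have hP : ∀ t s, P.real (symmDiff {ω | X t ω = s} (A t s)) ≤ ε / (2 * (Fintype.card S + 1)) :=
    fun t s => ENNReal.toReal_le_of_le_ofReal hδ.le (hPA t s).le
  change (ofProcess P X hX).d x y ≤ ε
  rw [ofProcess_d]
  calc P.real {ω | X x ω ≠ X y ω}
      ≤ P.real (⋃ s : S, (symmDiff {ω | X x ω = s} (A x s) ∪ symmDiff {ω | X y ω = s} (A y s))) := by
        refine measureReal_mono fun ω hω => Set.mem_iUnion.2 ⟨X x ω, ?_⟩
        have hω' : X y ω ≠ X x ω := fun h => hω h.symm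
        -- For `s = X x ω`, the point lies in the level set of `X x` but not of `X y`, so the common
        -- approximant errs at `ω` for one of them.
        rw [hAxy]
        by_cases h : ω ∈ A y (X x ω)
        · exact Or.inr (Or.inr ⟨h, hω'⟩)
        · exact Or.inl (Or.inl ⟨rfl, h⟩)
    _ ≤ ∑ s : S, (P.real (symmDiff {ω | X x ω = s} (A x s))
          + P.real (symmDiff {ω | X y ω = s} (A y s))) :=
        (measureReal_iUnion_fintype_le _).trans
          (Finset.sum_le_sum fun s _ => measureReal_union_le _ _)
    _ ≤ ∑ s : S, (ε / (2 * (Fintype.card S + 1)) + ε / (2 * (Fintype.card S + 1))) :=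
        Finset.sum_le_sum fun s _ => add_le_add (hP x s) (hP y s)
    _ = ε * (Fintype.card S / (Fintype.card S + 1)) := by
        rw [Finset.sum_const, Finset.card_univ, nsmul_eq_mul]
        field_simp
        ring
    _ ≤ ε := mul_le_of_le_one_right hε.le (div_le_one_of_le₀ (by linarith) (by positivity))

theorem exists_eventual_value {x : ℕ → Ω → S} (hx : ∀ n s, MeasurableSet {ω | x n ω = s}) :
    ∃ f : Ω → S, (∀ s, MeasurableSet {ω | f ω = s}) ∧
      ∀ ω s, (∀ᶠ n in Filter.atTop, x n ω = s) → f ω = s := by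
  classical
  let f : Ω → S := fun ω =>
    if h : ∃ s, ∀ᶠ n in Filter.atTop, x n ω = s then h.choose else x 0 ω
  have hf : ∀ ω s, (∀ᶠ n in Filter.atTop, x n ω = s) → f ω = s := fun ω s hs => by
    have h : ∃ s, ∀ᶠ n in Filter.atTop, x n ω = s := ⟨s, hs⟩
    obtain ⟨n, h1, h2⟩ := (h.choose_spec.and hs).exists
    simp only [f, dif_pos h]
    rw [← h1, h2]
  have hm : ∀ s, MeasurableSet {ω | ∀ᶠ n in Filter.atTop, x n ω = s} := fun s => by
    simp only [Filter.eventually_atTop, Set.ofPred_exists, Set.ofPred_forall]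
    exact MeasurableSet.iUnion fun N => MeasurableSet.iInter fun n => MeasurableSet.iInter fun _ =>
      hx n s
  refine ⟨f, fun s => ?_, hf⟩
  have : {ω | f ω = s} = {ω | ∀ᶠ n in Filter.atTop, x n ω = s} ∪
      ((⋃ s : S, {ω | ∀ᶠ n in Filter.atTop, x n ω = s})ᶜ ∩ {ω | x 0 ω = s}) := by
    ext ω
    by_cases h : ∃ s, ∀ᶠ n in Filter.atTop, x n ω = s
    · obtain ⟨s', hs'⟩ := h
      have h1 := hf ω s' hs'
      constructor
      · intro (h2 : f ω = s)
        left
        rw [← h2, h1]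
        exact hs'
      · rintro (h2 | ⟨h2, -⟩)
        · exact hf ω s h2
        · exact absurd (Set.mem_iUnion.2 ⟨s', hs'⟩) h2
    · have h1 : f ω = x 0 ω := dif_neg h
      constructor
      · intro (h2 : f ω = s)
        exact Or.inr ⟨fun h3 => h (Set.mem_iUnion.1 h3), h1.symm.trans h2⟩
      · rintro (h2 | ⟨-, h2⟩)
        · exact absurd ⟨s, h2⟩ h
        · exact h1.trans h2
  rw [this]
  exact (hm s).union ((MeasurableSet.iUnion hm).compl.inter (hx 0 s))

/-- For a sequence with summable successive distances, Borel–Cantelli makes the values almost surely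
eventually constant; the eventual value is the limit. -/
theorem ofProcess_isComplete
    (hsurj : ∀ f : Ω → S, (∀ s, MeasurableSet {ω | f ω = s}) → ∃ t, X t =ᵐ[P] f) :
    (ofProcess P X hX).IsComplete := by
  let _ := (ofProcess P X hX).pseudoMetric
  have hdist : ∀ a b : T, dist a b = P.real {ω | X a ω ≠ X b ω} := ofProcess_d hX
  refine Metric.complete_of_convergent_controlled_sequences (fun n => (1 / 2 : ℝ) ^ n)
    (fun n => by positivity) fun x hx => ?_
  have hsum : ∑' n, P {ω | X (x n) ω ≠ X (x (n + 1)) ω} ≠ ⊤ := by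
    refine ne_top_of_le_ne_top (Summable.tsum_ofReal_ne_top summable_geometric_two)
      (ENNReal.tsum_le_tsum fun n => ?_)
    rw [← ofReal_measureReal, ← hdist]
    exact ENNReal.ofReal_le_ofReal (hx n n (n + 1) le_rfl n.le_succ).le
  obtain ⟨f, hf, hlim⟩ := exists_eventual_value fun n => hX (x n)
  obtain ⟨t, ht⟩ := hsurj f hf
  have hev : ∀ᵐ ω ∂P, ∀ᶠ n in Filter.atTop, X (x n) ω = X t ω := by
    filter_upwards [ae_eventually_notMem hsum, ht] with ω hω htω
    obtain ⟨N, hN⟩ := Filter.eventually_atTop.1 hω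
    have hconst : ∀ n ≥ N, X (x n) ω = X (x N) ω := fun n hn => by
      induction n, hn using Nat.le_induction with
      | base => rfl
      | succ n hn ih => exact (not_not.1 (hN n hn)).symm.trans ih
    have h : ∀ᶠ n in Filter.atTop, X (x n) ω = X (x N) ω := Filter.eventually_atTop.2 ⟨N, hconst⟩
    rwa [htω, hlim ω _ h]
  refine ⟨t, tendsto_iff_dist_tendsto_zero.2 ?_⟩
  have h := tendsto_measure_of_ae_tendsto_indicator_of_isFiniteMeasure (μ := P) (A := ∅)
    (As := fun n => {ω | X (x n) ω ≠ X t ω}) Filter.atTop MeasurableSet.empty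
    (fun n => (measurableSet_eq_of_states (hX _) (hX _)).compl) (by
      filter_upwards [hev] with ω hω
      filter_upwards [hω] with n hn
      simpa using hn)
  simp only [hdist]
  simpa [measureReal_def, Function.comp_def] using (ENNReal.tendsto_toReal (measure_ne_top P ∅)).comp h

/-- A set of a divisible measure can be split according to prescribed masses. -/
theorem exists_prescribed_masses {S : Type*}
    (hdiv : ∀ A, MeasurableSet A → ∀ c, 0 ≤ c → c ≤ P.real A →
      ∃ B ⊆ A, MeasurableSet B ∧ P.real B = c)
    {p : S → ℝ} (hp : ∀ z, 0 ≤ p z) {s : Finset S} (hs : s.Nonempty) {A : Set Ω}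
    (hA : MeasurableSet A) (hpA : P.real A = ∑ z ∈ s, p z) :
    ∃ g : Ω → S, (∀ z, MeasurableSet {ω | g ω = z}) ∧ (∀ ω, g ω ∈ s) ∧
      ∀ z ∈ s, P.real (A ∩ {ω | g ω = z}) = p z := by
  classical
  induction hs using Finset.Nonempty.cons_induction generalizing A with
  | singleton a =>
    refine ⟨fun _ => a, fun z => MeasurableSet.const _, fun _ => Finset.mem_singleton_self a,
      fun z hz => ?_⟩
    obtain rfl := Finset.mem_singleton.1 hz
    simpa using hpA
  | cons a s has hs ih =>
    rw [Finset.sum_cons] at hpA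
    -- A piece of mass `p a` is cut off, and the rest is split by induction.
    obtain ⟨B, hBA, hB, hPB⟩ := hdiv A hA (p a) (hp a)
      (by rw [hpA]; linarith [Finset.sum_nonneg fun z (_ : z ∈ s) => hp z])
    obtain ⟨g, hg, hgs, hgp⟩ := ih (hA.diff hB)
      (by rw [measureReal_sdiff hBA hB, hpA, hPB]; ring)
    refine ⟨fun ω => if ω ∈ B then a else g ω, fun z => ?_, fun ω => ?_, fun z hz => ?_⟩
    · have : {ω | (if ω ∈ B then a else g ω) = z}
          = (B ∩ {_ω | a = z}) ∪ (Bᶜ ∩ {ω | g ω = z}) := by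
        ext ω
        by_cases h : ω ∈ B <;> simp [h]
      rw [this]
      exact (hB.inter (MeasurableSet.const _)).union (hB.compl.inter (hg z))
    · by_cases h : ω ∈ B <;> simp [h, hgs]
    · rcases Finset.mem_cons.1 hz with rfl | hz
      · rw [← hPB]
        congr 1
        ext ω
        have : g ω ≠ z := fun h => has (h ▸ hgs ω)
        by_cases h : ω ∈ B <;> simp [h, this]
        exact hBA h
      · rw [← hgp z hz]
        congr 1
        ext ω
        have : a ≠ z := fun h => has (h ▸ hz)
        by_cases h : ω ∈ B <;> simp [h, this]

theorem ofProcess_realizesExtensions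
    (hdiv : ∀ A, MeasurableSet A → ∀ c, 0 ≤ c → c ≤ P.real A →
      ∃ B ⊆ A, MeasurableSet B ∧ P.real B = c)
    (hsurj : ∀ f : Ω → S, (∀ s, MeasurableSet {ω | f ω = s}) → ∃ t, X t =ᵐ[P] f)
    (G : ProcessLaw S U) : (ofProcess P X hX).RealizesExtensions G := by
  intro k t u htu u'
  -- With no states, the law of `u'` would have total mass 0.
  have : Nonempty S := by
    by_contra h
    rw [not_nonempty_iff] at h
    simpa using G.prob_sum ![u']
  have hmeas : ∀ x : Fin k → S, MeasurableSet {ω | ∀ i, X (t i) ω = x i} := fun x => by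
    simpa only [Set.ofPred_forall] using MeasurableSet.iInter fun i => hX (t i) (x i)
  -- Each event `X t = x` is split in the proportions that `G` prescribes; the new variable follows
  -- `g x` there.
  choose g hg _ hgp using fun x : Fin k → S => exists_prescribed_masses hdiv
    (p := fun z => G.prob (Fin.snoc u u' : Fin (k + 1) → U) (Fin.snoc x z : Fin (k + 1) → S))
    (fun _ => G.prob_nonneg _ _) Finset.univ_nonempty (hmeas x)
    ((htu x).trans (G.prob_marginal u u' x).symm)
  obtain ⟨t', ht'⟩ := hsurj (fun ω => g (fun i => X (t i) ω) ω) fun z => by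
    have : {ω | g (fun i => X (t i) ω) ω = z}
        = ⋃ x : Fin k → S, {ω | ∀ i, X (t i) ω = x i} ∩ {ω | g x ω = z} := by
      ext ω
      simp only [← funext_iff, Set.mem_iUnion, Set.mem_inter_iff, Set.mem_ofPred_eq]
      exact ⟨fun h => ⟨_, rfl, h⟩, fun ⟨x, hx, h⟩ => hx ▸ h⟩
    rw [this]
    exact MeasurableSet.iUnion fun x => (hmeas x).inter (hg x z)
  refine ⟨t', fun y => ?_⟩
  rw [← Fin.snoc_init_self y, ← hgp (Fin.init y) (y (Fin.last k)) (Finset.mem_univ _)]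
  refine measureReal_congr ?_
  filter_upwards [ht'] with ω hω
  refine propext ?_
  change (∀ i : Fin (k + 1), X ((Fin.snoc t t' : Fin (k + 1) → T) i) ω
    = (Fin.snoc (Fin.init y) (y (Fin.last k)) : Fin (k + 1) → S) i) ↔
    (∀ i, X (t i) ω = Fin.init y i) ∧ g (Fin.init y) ω = y (Fin.last k)
  simp only [Fin.forall_fin_succ', Fin.snoc_castSucc, Fin.snoc_last, hω]
  refine and_congr_right fun h => ?_
  rw [funext h]

end RandomVariables

/-! ### The unit interval and the conclusion -/

/-- Subsets of the unit interval have subsets of any smaller measure. -/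
theorem exists_subset_unitInterval_measureReal_eq {A : Set ℝ} (hA : MeasurableSet A) {c : ℝ}
    (hc : 0 ≤ c) (hcA : c ≤ (volume.restrict (Set.Icc (0 : ℝ) 1)).real A) :
    ∃ B ⊆ A, MeasurableSet B ∧ (volume.restrict (Set.Icc (0 : ℝ) 1)).real B = c := by
  set P : Measure ℝ := volume.restrict (Set.Icc (0 : ℝ) 1) with hP
  -- The mass of `A` up to `x` grows no faster than length, so it takes every intermediate value.
  have hlip : LipschitzWith 1 fun x => P.real (A ∩ Set.Iic x) := by
    refine LipschitzWith.of_le_add fun x y => ?_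
    calc P.real (A ∩ Set.Iic x) ≤ P.real ((A ∩ Set.Iic y) ∪ Set.Ioc y x) := by
          refine measureReal_mono fun z ⟨hz, hzx⟩ => ?_
          rcases le_or_gt z y with h | h
          · exact Or.inl ⟨hz, h⟩
          · exact Or.inr ⟨h, hzx⟩
      _ ≤ P.real (A ∩ Set.Iic y) + P.real (Set.Ioc y x) := measureReal_union_le _ _
      _ ≤ P.real (A ∩ Set.Iic y) + dist x y := by
          gcongr
          calc P.real (Set.Ioc y x) ≤ volume.real (Set.Ioc y x) :=
                ENNReal.toReal_mono (by simp) (Measure.restrict_apply_le _ _)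
            _ ≤ dist x y := by
              rw [Real.volume_real_Ioc, Real.dist_eq]
              exact max_le (le_abs_self _) (abs_nonneg _)
  obtain ⟨x, -, hx⟩ := intermediate_value_Icc zero_le_one hlip.continuous.continuousOn
    (a := (0 : ℝ)) (b := 1) (show c ∈ Set.Icc _ _ by
      constructor
      · refine le_trans (le_of_eq ?_) hc
        refine (measureReal_eq_zero_iff (by finiteness)).2 (measure_mono_null Set.inter_subset_right ?_)
        rw [hP, Measure.restrict_apply measurableSet_Iic]
        exact measure_mono_null (t := {0}) (fun z hz => le_antisymm hz.1 hz.2.1) Real.volume_singleton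
      · refine hcA.trans (le_of_eq (measureReal_congr ?_))
        filter_upwards [ae_restrict_mem measurableSet_Icc] with z hz
        exact propext ⟨fun h => ⟨h, hz.2⟩, fun h => h.1⟩)
  exact ⟨A ∩ Set.Iic x, Set.inter_subset_left, hA.inter measurableSet_Iic, hx⟩

/-- Measurable maps with finitely many values, up to almost everywhere equality. -/
theorem exists_ae_representatives {Ω : Type} [MeasurableSpace Ω] (P : Measure Ω) (S : Type u) :
    ∃ (T : Type u) (X : T → Ω → S), (∀ t s, MeasurableSet {ω | X t ω = s}) ∧
      (∀ a b, X a =ᵐ[P] X b → a = b) ∧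
      ∀ f : Ω → S, (∀ s, MeasurableSet {ω | f ω = s}) → ∃ t, X t =ᵐ[P] f := by
  let r : Setoid {f : Ω → S // ∀ s, MeasurableSet {ω | f ω = s}} :=
    { r := fun f g => f.1 =ᵐ[P] g.1
      iseqv := ⟨fun _ => Filter.EventuallyEq.rfl, fun h => h.symm, fun h h' => h.trans h'⟩ }
  refine ⟨Quotient r, fun t => t.out.1, fun t => t.out.2, fun a b h => ?_, fun f hf => ?_⟩
  · rw [← a.out_eq, ← b.out_eq]
    exact Quotient.sound h
  · exact ⟨Quotient.mk r ⟨f, hf⟩, Quotient.mk_out (s := r) ⟨f, hf⟩⟩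

end ProcessLaw

theorem mainTheorem6 {S : Type u} [Fintype S] :
    ∃ (T : Type u) (Ω : Type) (_ : MeasurableSpace Ω) (P : Measure Ω) (_ : IsProbabilityMeasure P)
      (X : T → Ω → S) (hX : ∀ (t : T) (s : S), MeasurableSet {ω | X t ω = s}),
      (ProcessLaw.ofProcess P X hX).IsNondegenerate ∧
      (ProcessLaw.ofProcess P X hX).IsSeparable ∧
      (ProcessLaw.ofProcess P X hX).IsComplete ∧
      (ProcessLaw.ofProcess P X hX).IsUniversal ∧
      (ProcessLaw.ofProcess P X hX).IsUltrahomogeneous ∧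
      ∀ (T' : Type v) (G : ProcessLaw S T'),
        G.IsNondegenerate → G.IsSeparable → G.IsComplete → G.IsUniversal → G.IsUltrahomogeneous →
        ∃ φ : T' → T, G.IsIsomorphism (ProcessLaw.ofProcess P X hX) φ := by
  have hP : IsProbabilityMeasure (volume.restrict (Set.Icc (0 : ℝ) 1)) := ⟨by simp⟩
  obtain ⟨T, X, hX, hinj, hsurj⟩ :=
    ProcessLaw.exists_ae_representatives (volume.restrict (Set.Icc (0 : ℝ) 1)) S
  have hn := ProcessLaw.ofProcess_isNondegenerate hX hinj
  have hs := ProcessLaw.ofProcess_isSeparable (P := volume.restrict (Set.Icc (0 : ℝ) 1)) hX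
  have hc := ProcessLaw.ofProcess_isComplete hX hsurj
  have hdiv : ∀ A, MeasurableSet A → ∀ c, 0 ≤ c → c ≤ (volume.restrict (Set.Icc (0 : ℝ) 1)).real A →
      ∃ B ⊆ A, MeasurableSet B ∧ (volume.restrict (Set.Icc (0 : ℝ) 1)).real B = c :=
    fun A hA c hc hcA => ProcessLaw.exists_subset_unitInterval_measureReal_eq hA hc hcA
  refine ⟨T, ℝ, _, volume.restrict (Set.Icc (0 : ℝ) 1), hP, X, hX, hn, hs, hc,
    ProcessLaw.isUniversal_of_realizesExtensions fun V G =>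
      ProcessLaw.ofProcess_realizesExtensions hX hdiv hsurj G,
    ProcessLaw.isUltrahomogeneous_of_realizesExtensions
      (ProcessLaw.ofProcess_realizesExtensions hX hdiv hsurj _) hn hs hc,
    fun T' G hGn hGs hGc hGu hGh => ?_⟩
  -- Uniqueness is back-and-forth from the empty matching.
  obtain ⟨φ, hφ, -⟩ := ProcessLaw.IsMatching.exists_isIsomorphism
    (hGh.realizesExtensions hGu hGn _) (ProcessLaw.ofProcess_realizesExtensions hX hdiv hsurj G)
    hn hGs hs hGc hc (R₀ := ∅) (ProcessLaw.isMatching_empty _ _)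
  exact ⟨φ, hφ⟩
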